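/- For a finite graph $G$ on $n$ vertices, let $\mathbf I(G)$ be the random greedy independent set: the vertices are inspected one by one in a uniformly random order, and the current vertex is added to $\mathbf I(G)$ if it is not adjacent to any previously added vertex. Put $\iota(G)=|\mathbf I(G)|/n$. For a random rooted graph $(U,\rho)$, let $\sigma=(\sigma_v)_{v\in V(U)}$ be labels that are, given $U$, independent and uniform on $[0,1]$. The past $\mathcal P_\rho$ of the root is the set of vertices reachable from $\rho$ by a path along which the labels strictly decrease (with $\rho\in\mathcal P_\rho$). If $\mathcal P_\rho$ is almost surely finite, $(U,\rho)$ is said to have nonexplosive growth, and $\iota(U,\rho)$ is defined as the probability that $\rho$ belongs to the greedy independent set of the induced subgraph $U[\mathcal P_\rho]$ whose vertices are inspected in increasing order of their labels. Let $\lambda\in(0,\infty)$. (a) Let $\mathcal T_\lambda$ be the Galton–Watson tree with offspring distribution Poisson$(\lambda)$, rooted at its initial vertex. Then $\mathcal T_\lambda$ has nonexplosive growth and $$\iota(\mathcal T_\lambda)=\frac{\ln(1+\lambda)}{\lambda}.$$ (b) Let $G(n,\lambda/n)$ be the binomial random graph on $n$ vertices (each pair of vertices is joined independently with probability $\lambda/n$,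 where $n\ge\lambda$), and let the random order used by the greedy algorithm be independent of the graph. Then $\iota(G(n,\lambda/n))\sim\ln(1+\lambda)/\lambda$ with high probability; that is, for every $\varepsilon>0$, $$\Pr\left[\left|\iota(G(n,\lambda/n))-\frac{\ln(1+\lambda)}{\lambda}\right|\le\varepsilon\,\frac{\ln(1+\lambda)}{\lambda}\right]\longrightarrow 1\qquad(n\to\infty).$$ -/

import Mathlib

open MeasureTheory ProbabilityTheory Filter Topology
open scoped NNReal

noncomputable section

/-! ### The greedy maximal independent set -/

open Classical in
/-- The greedy algorithm: the vertices in the list `l` are inspected one by one in order, and the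
current vertex is added to the set built so far if it is not adjacent to any vertex added before.
Only adjacencies between vertices of `l` are used, so if `l` lists a vertex set `S` then this is the
greedy maximal independent set of the induced subgraph `G[S]` with respect to the order of `l`. -/
def greedyMIS {V : Type*} (G : SimpleGraph V) (l : List V) : Set V :=
  l.foldl (fun I v => if ∀ u ∈ I, ¬ G.Adj u v then insert v I else I) ∅

/-- The density `|I(G)| / n` of the greedy maximal independent set of a graph `G` on `n` vertices,
when the vertices are inspected in the order `π 0, π 1, …, π (n - 1)`. -/
def greedyDensity {n : ℕ} (G : SimpleGraph (Fin n)) (π : Equiv.Perm (Fin n)) : ℝ :=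
  ((greedyMIS G (List.ofFn π)).ncard : ℝ) / n

/-! ### Random rooted graphs

A random rooted graph is given by a law `μ` on the simple graphs on a fixed countable vertex type
`V` and a root `ρ : V`; what matters is the connected component of `ρ`. -/

/-- The law of a random labelling: independent labels, uniform on `[0, 1]`. -/
def labelLaw (V : Type*) : Measure (V → unitInterval) :=
  Measure.infinitePi fun _ : V => (volume : Measure unitInterval)

instance (V : Type*) : IsProbabilityMeasure (labelLaw V) := by
  unfold labelLaw; infer_instance

/-- The past of `v`: the vertices reachable from `v` by a path along which labels decrease. -/
def past {V : Type*} (G : SimpleGraph V) (s : V → unitInterval) (v : V) : Set V :=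
  {w | Relation.ReflTransGen (fun a b => G.Adj a b ∧ s b < s a) v w}

/-- Nonexplosive growth: the past of the root is almost surely finite. -/
def NonexplosiveGrowth {V : Type*} (μ : Measure (SimpleGraph V)) (ρ : V) : Prop :=
  ∀ᵐ p ∂(μ.prod (labelLaw V)), (past p.1 p.2 ρ).Finite

/-- The root belongs to the greedy maximal independent set of the subgraph induced by its past:
`l` lists the past of `ρ` in the order of increasing labels (so the past is finite). -/
def RootOccupied {V : Type*} (G : SimpleGraph V) (s : V → unitInterval) (ρ : V) : Prop :=
  ∃ l : List V, {v | v ∈ l} = past G s ρ ∧ l.Pairwise (fun a b => s a < s b) ∧ ρ ∈ greedyMIS G l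

/-- `ι(U, ρ)`: the probability that the root is in the greedy maximal independent set of its past. -/
def rootDensity {V : Type*} (μ : Measure (SimpleGraph V)) (ρ : V) : ℝ :=
  (μ.prod (labelLaw V)).real {p | RootOccupied p.1 p.2 ρ}

/-! ### The Poisson Galton–Watson tree -/

/-- The vertices of the family tree in which the vertex `v` has `c v` children
`v ++ [0], …, v ++ [c v - 1]`; the root is the empty sequence. -/
inductive IsTreeVertex (c : List ℕ → ℕ) : List ℕ → Prop
  | root : IsTreeVertex c []
  | child {v : List ℕ} {i : ℕ} : IsTreeVertex c v → i < c v → IsTreeVertex c (v ++ [i])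

/-- The family tree as a graph: every tree vertex is joined to its children. (Sequences that are not
tree vertices are isolated points, so the tree is the connected component of the root.) -/
def familyTree (c : List ℕ → ℕ) : SimpleGraph (List ℕ) :=
  SimpleGraph.fromRel fun u w => IsTreeVertex c u ∧ ∃ i, i < c u ∧ w = u ++ [i]

/-- The law of the Galton–Watson tree with offspring distribution Poisson(`r`): the numbers of
children are independent Poisson(`r`) variables. The root is `[]`. -/
def poissonGW (r : ℝ≥0) : Measure (SimpleGraph (List ℕ)) :=
  (Measure.infinitePi fun _ : List ℕ => poissonMeasure r).map familyTree

lemma measurableSet_isTreeVertex (v : List ℕ) :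
    MeasurableSet {c : List ℕ → ℕ | IsTreeVertex c v} := by
  induction v using List.reverseRecOn with
  | nil => simp [IsTreeVertex.root]
  | append_singleton v i ih =>
    have h : {c : List ℕ → ℕ | IsTreeVertex c (v ++ [i])}
        = {c | IsTreeVertex c v} ∩ {c | i < c v} := by
      ext c
      constructor
      · intro h
        generalize hw : v ++ [i] = w at h
        cases h with
        | root => simp at hw
        | child h1 h2 =>
          obtain ⟨rfl, h3⟩ := List.append_inj' hw rfl
          obtain rfl : i = _ := by simpa using h3
          exact ⟨h1, h2⟩
      · rintro ⟨h1, h2⟩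
        exact .child h1 h2
    rw [h]
    exact ih.inter (measurableSet_lt measurable_const (measurable_pi_apply v))

/-- The family tree is a measurable function of the numbers of children, so `poissonGW r` is
a genuine image measure. -/
lemma measurable_familyTree : Measurable familyTree := by
  have key : ∀ u w : List ℕ,
      Measurable fun c : List ℕ → ℕ => IsTreeVertex c u ∧ ∃ i, i < c u ∧ w = u ++ [i] := by
    intro u w
    refine .and (measurableSet_setOfPred.1 (measurableSet_isTreeVertex u)) (.exists fun i => ?_)
    exact .and (measurableSet_setOfPred.1
      (measurableSet_lt measurable_const (measurable_pi_apply u))) measurable_const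
  rw [SimpleGraph.measurable_iff_adj]
  intro u w
  simp only [familyTree, SimpleGraph.fromRel_adj]
  exact .and measurable_const (.or (key u w) (key w u))

instance (r : ℝ≥0) : IsProbabilityMeasure (poissonGW r) :=
  Measure.isProbabilityMeasure_map measurable_familyTree.aemeasurable

/-! ### Binomial random graphs -/

instance (n : ℕ) : MeasurableSpace (Equiv.Perm (Fin n)) := ⊤

/-- The joint law of the binomial random graph `G(n, r / n)` and of an independent uniformly random
order of its vertices. (For `r > n` the edge probability is cut off at `1`.) -/
def binomialGraphOrderLaw (r : ℝ≥0) (n : ℕ) :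
    Measure (SimpleGraph (Fin n) × Equiv.Perm (Fin n)) :=
  (SimpleGraph.binomialRandom (Fin n) (Set.projIcc (0 : ℝ) 1 zero_le_one ((r : ℝ) / n))).prod
    (PMF.uniformOfFintype (Equiv.Perm (Fin n))).toMeasure

/-- `X n ∼ a` with high probability: for every `ε > 0`, the probability that `X n` lies within
a factor `1 ± ε` of `a` tends to `1`. -/
def AsympWHP {Ω : ℕ → Type*} [∀ n, MeasurableSpace (Ω n)] (P : ∀ n, Measure (Ω n))
    (X : ∀ n, Ω n → ℝ) (a : ℝ) : Prop :=
  ∀ ε : ℝ, 0 < ε → Tendsto (fun n => (P n).real {ω | |X n ω - a| ≤ ε * |a|}) atTop (𝓝 1)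

end

noncomputable section

/-! ### The greedy algorithm on lists -/

section Greedy

variable {V : Type*}

/-! Tree. A label-decreasing walk from the root only descends, since a parent precedes its child on
it. Let `f_n(t)` be the probability that the root has label below `t` and starts a descent of `n`
edges. The subtrees of the children are independent copies of the tree, so conditioning on the root
and applying the Poisson generating function (`probBelow_forall_not`) gives `f_{n+1}(t) = t - ∫₀ᵗ
exp(-r f_n)`. Hence `f_n(1) ≤ r^n / (n+1)!` tends to `0`, and the past is almost surely finite. A
vertex is then occupied iff no earlier neighbour is (`rootOccupied_iff`), so the probability `f(t)`
that the root is occupied with label below `t` satisfies `f(t) = ∫₀ᵗ exp(-r f)`. Thus `exp (r f(t))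
= 1 + r t`, and `t = 1` gives the density.

Random graph. No local limit is needed. For a fixed order, the size `k` of the greedy set is a
Markov chain growing with probability `(1 - p)^k`. With `a = 1 / (1 - p)` the mean of `a^k` rises by
exactly `a - 1` per step, so after `n` steps `a^|I|` has mean `1 + n (a - 1)`; its variance is `(a -
1)^3 n (n - 1) / 2`. For `p = r / n` these are `1 + r + o(1)` and `O(1 / n)`. Chebyshev's inequality
gives `a^|I| → 1 + r` in probability, and `|I| / n = log (a^|I|) / (n log a)` with `n log a → r`. -/

lemma greedyMIS_nil (G : SimpleGraph V) : greedyMIS G [] = ∅ := rfl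

open Classical in
lemma greedyMIS_append_singleton (G : SimpleGraph V) (l : List V) (v : V) :
    greedyMIS G (l ++ [v]) =
      if ∀ u ∈ greedyMIS G l, ¬ G.Adj u v then insert v (greedyMIS G l) else greedyMIS G l := by
  simp only [greedyMIS, List.foldl_append, List.foldl_cons, List.foldl_nil]
  congr

lemma mem_greedyMIS_append_singleton (G : SimpleGraph V) (l : List V) (v w : V) :
    w ∈ greedyMIS G (l ++ [v]) ↔
      w ∈ greedyMIS G l ∨ w = v ∧ ∀ u ∈ greedyMIS G l, ¬ G.Adj u v := by
  rw [greedyMIS_append_singleton]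
  split_ifs with h <;> simp [h]; tauto

lemma mem_of_mem_greedyMIS {G : SimpleGraph V} {l : List V} {v : V} (h : v ∈ greedyMIS G l) :
    v ∈ l := by
  induction l using List.reverseRecOn with
  | nil => simp [greedyMIS_nil] at h
  | append_singleton l a ih =>
    rw [mem_greedyMIS_append_singleton] at h
    rcases h with h | ⟨rfl, -⟩
    · simp [ih h]
    · simp

lemma finite_greedyMIS (G : SimpleGraph V) (l : List V) : (greedyMIS G l).Finite :=
  l.finite_toSet.subset fun _ h => mem_of_mem_greedyMIS h

/-- The greedy set depends only on the adjacencies between inspected vertices. -/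
lemma greedyMIS_congr {G H : SimpleGraph V} {l : List V}
    (h : ∀ u ∈ l, ∀ v ∈ l, (G.Adj u v ↔ H.Adj u v)) : greedyMIS G l = greedyMIS H l := by
  induction l using List.reverseRecOn with
  | nil => rfl
  | append_singleton l a ih =>
    have ih' := ih fun u hu v hv => h u (by simp [hu]) v (by simp [hv])
    ext w
    rw [mem_greedyMIS_append_singleton, mem_greedyMIS_append_singleton, ih']
    refine or_congr Iff.rfl (and_congr Iff.rfl (forall₂_congr fun u hu => ?_))
    rw [h u (by simp [mem_of_mem_greedyMIS hu]) a (by simp)]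

end Greedy

/-! ### Moments of the size of the greedy independent set of the binomial random graph -/

section Binomial

variable {V : Type*}

open unitInterval

/-- The law of the indicators of the edges of the binomial random graph. -/
def edgeLaw (V : Type*) (p : I) : Measure (Sym2 V → Prop) :=
  Measure.infinitePi fun e : Sym2 V =>
    toNNReal p • Measure.dirac (¬ e.IsDiag) + toNNReal (σ p) • Measure.dirac False

/-- The graph with given edge indicators. -/
def graphOfEdges (x : Sym2 V → Prop) : SimpleGraph V := SimpleGraph.fromEdgeSet {e | x e}

lemma measurable_graphOfEdges : Measurable (graphOfEdges (V := V)) := by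
  rw [SimpleGraph.measurable_iff_adj]
  intro u v
  simp only [graphOfEdges, SimpleGraph.fromEdgeSet_adj, Set.mem_ofPred_eq]
  exact .and (measurable_pi_apply _) measurable_const

lemma binomialRandom_eq_map_edgeLaw [Countable V] (p : I) :
    SimpleGraph.binomialRandom V p = (edgeLaw V p).map graphOfEdges := by
  rw [SimpleGraph.binomialRandom_eq_map, setBernoulli_eq_map, Measure.map_map]
  · simp only [edgeLaw, Set.mem_compl_iff, Sym2.mem_diagSet]
    rfl
  · fun_prop
  · exact MeasurableEquiv.setOfPred.measurable

/-- For finite `V` this makes all sets of graphs measurable and all real functions of the graph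
integrable. -/
instance [Countable V] : MeasurableSingletonClass (SimpleGraph V) where
  measurableSet_singleton G := by
    have h : ({G} : Set (SimpleGraph V)) = ⋂ u, ⋂ v, {H | H.Adj u v ↔ G.Adj u v} := by
      ext H
      simp [SimpleGraph.ext_iff, funext_iff]
    rw [h]
    refine .iInter fun u => .iInter fun v => measurableSet_setOfPred.2 ?_
    exact .iff (by fun_prop) measurable_const

lemma edgeLaw_forall_not (p : I) {S : Finset V} {v : V} (hv : v ∉ S) :
    (edgeLaw V p) {x | ∀ u ∈ S, ¬ (graphOfEdges x).Adj u v} = toNNReal (σ p) ^ S.card := by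
  classical
  have h : {x : Sym2 V → Prop | ∀ u ∈ S, ¬ (graphOfEdges x).Adj u v}
      = Set.pi (S.image fun u => s(u, v) : Finset (Sym2 V)) fun _ => {False} := by
    ext x
    simp only [graphOfEdges, SimpleGraph.fromEdgeSet_adj, Set.mem_ofPred_eq, Set.mem_pi,
      Finset.coe_image, Set.forall_mem_image, Set.mem_singleton_iff, eq_iff_iff, iff_false,
      Finset.mem_coe]
    refine forall₂_congr fun u hu => ?_
    have : u ≠ v := fun h => hv (h ▸ hu)
    simp [this]
  rw [h, edgeLaw, Measure.infinitePi_pi]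
  · rw [Finset.prod_image]
    · rw [Finset.prod_congr rfl (g := fun _ => (toNNReal (σ p) : ENNReal))]
      · simp
      · intro u hu
        have : u ≠ v := fun h => hv (h ▸ hu)
        simp [this]
    · intro a ha b hb hab
      have hne : a ≠ v := fun h => hv (h ▸ ha)
      simpa [hne] using hab
  · intro i _; exact .of_discrete

/-- The greedy set of `l` is read off the edges inside `l`, the second event off the edges from `S`
to `v`. These edge sets are disjoint because `v ∉ l`, so the events are independent. -/
lemma edgeLaw_greedyMIS_inter (p : I) {l : List V} {S : Finset V} {v : V} (hv : v ∉ l)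
    (hS : ∀ u ∈ S, u ∈ l) :
    (edgeLaw V p) ({x | greedyMIS (graphOfEdges x) l = S} ∩
        {x | ∀ u ∈ S, ¬ (graphOfEdges x).Adj u v}) =
      (edgeLaw V p) {x | greedyMIS (graphOfEdges x) l = S} * toNNReal (σ p) ^ S.card := by
  classical
  rw [← edgeLaw_forall_not p (fun h => hv (hS v h))]
  let T₁ : Finset (Sym2 V) := l.toFinset.sym2
  let T₂ : Finset (Sym2 V) := S.image fun u => s(u, v)
  have hd : Disjoint T₁ T₂ := by
    rw [Finset.disjoint_left]
    intro e h1 h2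
    obtain ⟨u, hu, rfl⟩ := Finset.mem_image.1 h2
    rw [Finset.mk_mem_sym2_iff] at h1
    exact hv (by simpa using h1.2)
  have hind := iIndepFun.indepFun_finset T₁ T₂ hd
    (iIndepFun_infinitePi (X := fun (_ : Sym2 V) (y : Prop) => y)
      (P := fun e : Sym2 V =>
        toNNReal p • Measure.dirac (¬ e.IsDiag) + toNNReal (σ p) • Measure.dirac False)
      (fun _ => measurable_id)) (fun e => measurable_pi_apply e)
  -- Edges outside `T₁` are declared absent, which is harmless by `greedyMIS_congr`.
  have hA : {x : Sym2 V → Prop | greedyMIS (graphOfEdges x) l = S} =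
      (fun x (e : T₁) => x e) ⁻¹' {y | greedyMIS (graphOfEdges
        fun e => ∃ h : e ∈ T₁, y ⟨e, h⟩) l = S} := by
    ext x
    simp only [Set.mem_ofPred_eq, Set.mem_preimage]
    rw [greedyMIS_congr]
    intro u hu w hw
    simp [graphOfEdges, T₁, hu, hw]
  have hB : {x : Sym2 V → Prop | ∀ u ∈ S, ¬ (graphOfEdges x).Adj u v} =
      (fun x (e : T₂) => x e) ⁻¹' {y | ∀ u ∈ S, ¬ (graphOfEdges
        fun e => ∃ h : e ∈ T₂, y ⟨e, h⟩).Adj u v} := by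
    ext x
    simp only [Set.mem_ofPred_eq, Set.mem_preimage]
    refine forall₂_congr fun u hu => ?_
    have : ∃ a ∈ S, a = u ∨ a = v ∧ v = u := ⟨u, hu, Or.inl rfl⟩
    simp [graphOfEdges, T₂, this]
  rw [hA, hB]
  exact hind.measure_inter_preimage_eq_mul _ _ .of_discrete .of_discrete

end Binomial

/-! ### The size of the greedy set as a Markov chain, and its exponential moments -/

section BinomialMoments

variable {V : Type*} [Finite V]

open unitInterval

/-- Whether the vertex `v ∉ l` is free of neighbours in the greedy set of `l` is, given that set,
decided by edges that have not been inspected. -/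
lemma binomialRandom_real_greedyMIS_inter (p : I) {l : List V} {S : Finset V} {v : V} (hv : v ∉ l)
    (hS : ∀ u ∈ S, u ∈ l) :
    (SimpleGraph.binomialRandom V p).real
        {G | greedyMIS G l = S ∧ ∀ u ∈ S, ¬ G.Adj u v} =
      (SimpleGraph.binomialRandom V p).real {G | greedyMIS G l = S} * (1 - p : ℝ) ^ S.card := by
  have h := edgeLaw_greedyMIS_inter p hv hS
  rw [binomialRandom_eq_map_edgeLaw, map_measureReal_apply measurable_graphOfEdges .of_discrete,
    map_measureReal_apply measurable_graphOfEdges .of_discrete]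
  have h' := congrArg ENNReal.toReal h
  rw [ENNReal.toReal_mul, ENNReal.toReal_pow] at h'
  simpa [Measure.real, Set.preimage, Set.inter_def] using h'

/-- Both integrands are split according to the value `S` of the greedy set; independence is applied
to each term. -/
lemma integral_greedyMIS_indicator (p : I) {l : List V} {v : V} (hv : v ∉ l) (F : ℕ → ℝ) :
    ∫ G, {G : SimpleGraph V | ∀ u ∈ greedyMIS G l, ¬ G.Adj u v}.indicator
          (fun G => F (greedyMIS G l).ncard) G
        ∂(SimpleGraph.binomialRandom V p) =
      ∫ G, F (greedyMIS G l).ncard * (1 - p : ℝ) ^ (greedyMIS G l).ncard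
        ∂(SimpleGraph.binomialRandom V p) := by
  classical
  have := Fintype.ofFinite V
  have hL : ∀ G : SimpleGraph V,
      {G : SimpleGraph V | ∀ u ∈ greedyMIS G l, ¬ G.Adj u v}.indicator
          (fun G => F (greedyMIS G l).ncard) G =
      ∑ S : Finset V, {G : SimpleGraph V | greedyMIS G l = S ∧ ∀ u ∈ S, ¬ G.Adj u v}.indicator
        (fun _ => F S.card) G := by
    intro G
    rw [Finset.sum_eq_single (greedyMIS G l).toFinset]
    · simp [Set.indicator_apply, Set.ncard_eq_toFinset_card']
    · intro S _ hS
      rw [Set.indicator_of_notMem]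
      rintro ⟨h, -⟩
      exact hS (by ext; simp [h])
    · simp
  have hR : ∀ G : SimpleGraph V,
      F (greedyMIS G l).ncard * (1 - p : ℝ) ^ (greedyMIS G l).ncard =
      ∑ S : Finset V, {G : SimpleGraph V | greedyMIS G l = S}.indicator
        (fun _ => F S.card * (1 - p : ℝ) ^ S.card) G := by
    intro G
    rw [Finset.sum_eq_single (greedyMIS G l).toFinset]
    · simp [Set.ncard_eq_toFinset_card']
    · intro S _ hS
      rw [Set.indicator_of_notMem]
      intro h
      exact hS (by ext; simp [h.out])
    · simp
  simp_rw [hL, hR]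
  rw [integral_finsetSum _ fun _ _ => .of_finite, integral_finsetSum _ fun _ _ => .of_finite]
  refine Finset.sum_congr rfl fun S _ => ?_
  rw [integral_indicator_const _ .of_discrete, integral_indicator_const _ .of_discrete]
  by_cases hS : ∀ u ∈ S, u ∈ l
  · rw [binomialRandom_real_greedyMIS_inter p hv hS]
    simp only [smul_eq_mul]
    ring
  · have h0 : {G : SimpleGraph V | greedyMIS G l = S} = ∅ := by
      ext G
      simp only [Set.mem_ofPred_eq, Set.mem_empty_iff_false, iff_false]
      intro h
      refine hS fun u hu => mem_of_mem_greedyMIS (G := G) ?_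
      rw [h]; exact hu
    have h1 : {G : SimpleGraph V | greedyMIS G l = S ∧ ∀ u ∈ S, ¬ G.Adj u v} = ∅ :=
      Set.subset_eq_empty (fun G hG => hG.1) h0
    rw [h0, h1]
    simp

/-- The size of the greedy set is a Markov chain: from `k` it grows with probability
`(1 - p) ^ k`. -/
lemma integral_greedyMIS_append_singleton (p : I) {l : List V} {v : V} (hv : v ∉ l) (F : ℕ → ℝ) :
    ∫ G, F (greedyMIS G (l ++ [v])).ncard ∂(SimpleGraph.binomialRandom V p) =
      ∫ G, F (greedyMIS G l).ncard ∂(SimpleGraph.binomialRandom V p) +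
      ∫ G, (F ((greedyMIS G l).ncard + 1) - F (greedyMIS G l).ncard) *
        (1 - p : ℝ) ^ (greedyMIS G l).ncard ∂(SimpleGraph.binomialRandom V p) := by
  classical
  rw [← integral_greedyMIS_indicator p hv fun k => F (k + 1) - F k,
    ← integral_add .of_finite .of_finite]
  refine integral_congr_ae (.of_forall fun G => ?_)
  have hn : v ∉ greedyMIS G l := fun h => hv (mem_of_mem_greedyMIS h)
  simp only [greedyMIS_append_singleton, Set.indicator_apply, Set.mem_ofPred_eq]
  split_ifs with h
  · rw [Set.ncard_insert_of_notMem hn (finite_greedyMIS G l)]; ring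
  · ring

variable {p : I} {a : ℝ}

/-- Since `a (1 - p) = 1`, the expected increment `(a^(k+1) - a^k) (1 - p)^k` equals `a - 1`
whatever `k` is. -/
lemma integral_pow_greedyMIS (ha : a * (1 - p) = 1) {l : List V} (hl : l.Nodup) :
    ∫ G, a ^ (greedyMIS G l).ncard ∂(SimpleGraph.binomialRandom V p) =
      1 + l.length * (a - 1) := by
  induction l using List.reverseRecOn with
  | nil => simp [greedyMIS_nil]
  | append_singleton l v ih =>
    rw [List.nodup_append'] at hl
    have hv : v ∉ l := fun h => hl.2.2 h (by simp)
    rw [integral_greedyMIS_append_singleton p hv, ih hl.1]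
    have : ∀ k : ℕ, (a ^ (k + 1) - a ^ k) * (1 - p : ℝ) ^ k = a - 1 := by
      intro k
      have h1 : a ^ k * (1 - p : ℝ) ^ k = 1 := by rw [← mul_pow, ha, one_pow]
      linear_combination (a - 1) * h1
    simp only [this]
    simp
    ring

/-- Here the expected increment from `k` is `(a² - 1) a^k`, so the first moment closes the
recursion. -/
lemma integral_sq_pow_greedyMIS (ha : a * (1 - p) = 1) {l : List V} (hl : l.Nodup) :
    ∫ G, (a ^ 2) ^ (greedyMIS G l).ncard ∂(SimpleGraph.binomialRandom V p) =
      1 + (a ^ 2 - 1) * (l.length + (a - 1) * (l.length * (l.length - 1) / 2)) := by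
  induction l using List.reverseRecOn with
  | nil => simp [greedyMIS_nil]
  | append_singleton l v ih =>
    rw [List.nodup_append'] at hl
    have hv : v ∉ l := fun h => hl.2.2 h (by simp)
    rw [integral_greedyMIS_append_singleton p hv, ih hl.1]
    have : ∀ k : ℕ, ((a ^ 2) ^ (k + 1) - (a ^ 2) ^ k) * (1 - p : ℝ) ^ k = (a ^ 2 - 1) * a ^ k := by
      intro k
      have h1 : a ^ k * (1 - p : ℝ) ^ k = 1 := by rw [← mul_pow, ha, one_pow]
      have h2 : (a ^ 2) ^ k = a ^ k * a ^ k := by rw [← mul_pow, sq]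
      rw [pow_succ, h2]
      linear_combination (a ^ 2 - 1) * a ^ k * h1
    simp only [this]
    rw [integral_const_mul, integral_pow_greedyMIS ha hl.1]
    simp
    ring

/-- The lower powers of `a - 1` cancel. The surviving cube makes the variance `O(1 / n)` when `a -
1` is of order `1 / n`. -/
lemma integral_sq_sub_greedyMIS (ha : a * (1 - p) = 1) {l : List V} (hl : l.Nodup) :
    ∫ G, (a ^ (greedyMIS G l).ncard - (1 + l.length * (a - 1))) ^ 2
      ∂(SimpleGraph.binomialRandom V p) =
      (a - 1) ^ 3 * (l.length * (l.length - 1) / 2) := by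
  set m : ℝ := 1 + l.length * (a - 1) with hm
  have h : ∀ k : ℕ, (a ^ k - m) ^ 2 = ((a ^ 2) ^ k - 2 * m * a ^ k) + m ^ 2 := by
    intro k
    have h2 : (a ^ 2) ^ k = a ^ k * a ^ k := by rw [← mul_pow, sq]
    rw [h2]; ring
  simp only [h]
  rw [integral_add .of_finite .of_finite, integral_sub .of_finite .of_finite, integral_const_mul,
    integral_pow_greedyMIS ha hl, integral_sq_pow_greedyMIS ha hl]
  simp [hm]
  ring

/-- Chebyshev's inequality for `(1 - p) ^ (-|I|)`. -/
lemma binomialRandom_real_greedyMIS_le (ha : a * (1 - p) = 1) {l : List V} (hl : l.Nodup)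
    {δ : ℝ} (hδ : 0 < δ) :
    (SimpleGraph.binomialRandom V p).real
        {G | δ ≤ |a ^ (greedyMIS G l).ncard - (1 + l.length * (a - 1))|} ≤
      (a - 1) ^ 3 * (l.length * (l.length - 1) / 2) / δ ^ 2 := by
  rw [le_div_iff₀ (by positivity), ← integral_sq_sub_greedyMIS ha hl, mul_comm]
  refine le_trans (le_of_eq ?_) (mul_meas_ge_le_integral_of_nonneg (ε := δ ^ 2)
    (.of_forall fun _ => sq_nonneg _) .of_finite)
  congr 3
  ext G
  rw [← sq_abs (_ - _), sq_le_sq₀ hδ.le (abs_nonneg _)]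

end BinomialMoments

/-! ### The greedy density of the binomial random graph -/

/-- Chebyshev's bound is the same for every order, so it survives integration over the permutation.
-/
lemma binomialGraphOrderLaw_real_le {r : ℝ≥0} {n : ℕ} (hn : (r : ℝ) < n) {δ : ℝ} (hδ : 0 < δ) :
    (binomialGraphOrderLaw r n).real
        {x | δ ≤ |((n : ℝ) / (n - r)) ^ (greedyMIS x.1 (List.ofFn x.2)).ncard
          - (1 + n * (r / (n - r)))|} ≤
      (r / (n - r)) ^ 3 * (n * (n - 1) / 2) / δ ^ 2 := by
  have hn0 : (0 : ℝ) < n := r.2.trans_lt hn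
  have hnr : (n : ℝ) - r ≠ 0 := (sub_pos.2 hn).ne'
  have hp : ((Set.projIcc (0 : ℝ) 1 zero_le_one ((r : ℝ) / n) : unitInterval) : ℝ) = r / n := by
    rw [Set.projIcc_of_mem zero_le_one
      ⟨by positivity, (div_le_one hn0).2 hn.le⟩]
  have ha : (n : ℝ) / (n - r) *
      (1 - ((Set.projIcc (0 : ℝ) 1 zero_le_one ((r : ℝ) / n) : unitInterval) : ℝ)) = 1 := by
    rw [hp]; field_simp
  have ha1 : (n : ℝ) / (n - r) - 1 = r / (n - r) := by field_simp; ring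
  have hle : 0 ≤ (r / (n - r)) ^ 3 * (n * (n - 1) / 2) / δ ^ 2 := by
    have h1 : (1 : ℝ) ≤ n := by exact_mod_cast (Nat.cast_pos.1 hn0 : 0 < n)
    have h2 : (0 : ℝ) < n - r := sub_pos.2 hn
    have h3 : (0 : ℝ) ≤ n - 1 := sub_nonneg.2 h1
    positivity
  rw [Measure.real, binomialGraphOrderLaw, Measure.prod_apply_symm .of_discrete]
  refine ENNReal.toReal_le_of_le_ofReal hle ?_
  refine (lintegral_mono (g := fun _ => ENNReal.ofReal _) fun π => ?_).trans_eq
    (by rw [lintegral_const, measure_univ, mul_one])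
  rw [ENNReal.le_ofReal_iff_toReal_le (measure_ne_top _ _) hle]
  have := binomialRandom_real_greedyMIS_le ha (List.nodup_ofFn.2 π.injective) hδ
  rw [ha1, List.length_ofFn] at this
  exact this

lemma tendsto_natCast_div_sub (r : ℝ) :
    Tendsto (fun n : ℕ => (n : ℝ) / (n - r)) atTop (𝓝 1) := by
  have h := tendsto_natCast_div_add_atTop (𝕜 := ℝ) (-r)
  simpa [sub_eq_add_neg] using h

lemma tendsto_natCast_mul_log (r : ℝ) :
    Tendsto (fun n : ℕ => (n : ℝ) * Real.log (n / (n - r))) atTop (𝓝 r) := by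
  have h := (Real.tendsto_mul_log_one_add_div_atTop (-r)).comp tendsto_natCast_atTop_atTop
  have h2 := h.neg
  rw [neg_neg] at h2
  refine h2.congr' ?_
  filter_upwards [eventually_gt_atTop 0] with n hn
  have hn0 : (n : ℝ) ≠ 0 := by positivity
  have : (n : ℝ) / (n - r) = (1 + -r / n)⁻¹ := by
    rw [show (1 : ℝ) + -r / n = (n - r) / n by field_simp; ring, inv_div]
  simp only [Function.comp]
  rw [this, Real.log_inv]
  ring

theorem asympWHP_greedyDensity_binomialRandom {r : ℝ≥0} (hr : 0 < r) :
    AsympWHP (binomialGraphOrderLaw r) (fun _ p => greedyDensity p.1 p.2)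
      (Real.log (1 + (r : ℝ)) / (r : ℝ)) := by
  intro ε hε
  have hr' : (0 : ℝ) < r := hr
  set L := Real.log (1 + (r : ℝ)) / (r : ℝ) with hL
  have hL0 : 0 < L := div_pos (Real.log_pos (by linarith)) hr'
  -- The density is `log x / y` at `x = a^|I|`, `y = n log a`, with `(x, y)` close to `(1 + r, r)`.
  have hcont : ContinuousAt (fun x : ℝ × ℝ => Real.log x.1 / x.2) (1 + (r : ℝ), (r : ℝ)) := by
    refine ContinuousAt.div (ContinuousAt.log continuousAt_fst ?_) continuousAt_snd ?_
    · simp only; positivity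
    · exact hr'.ne'
  obtain ⟨δ, hδ, hδ'⟩ := Metric.continuousAt_iff.1 hcont (ε * |L|) (by positivity)
  have ht1 : Tendsto (fun n : ℕ => 1 + n * ((r : ℝ) / (n - r))) atTop (𝓝 (1 + r)) := by
    have := ((tendsto_natCast_div_sub r).mul_const (r : ℝ)).const_add 1
    rw [one_mul] at this
    refine this.congr fun n => ?_
    ring
  have hbound : Tendsto (fun n : ℕ => 1 - ((r : ℝ) / (n - r)) ^ 3 * (n * (n - 1) / 2) / (δ / 2) ^ 2)
      atTop (𝓝 1) := by
    have e1 : Tendsto (fun n : ℕ => (r : ℝ) / (n - r)) atTop (𝓝 0) := by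
      refine Tendsto.const_div_atTop ?_ _
      exact tendsto_atTop_add_const_right _ _ tendsto_natCast_atTop_atTop
    have e2 : Tendsto (fun n : ℕ => (n : ℝ) * (r / (n - r))) atTop (𝓝 r) := by
      have := (tendsto_natCast_div_sub r).mul_const (r : ℝ)
      rw [one_mul] at this
      exact this.congr fun n => by ring
    -- With `x = r / (n - r)`, `x³ n (n - 1) = x · (n x) · (n x - x)`, and `n x → r` while `x → 0`.
    have e3 := (((e1.mul (e2.mul (e2.sub e1))).div_const 2).div_const ((δ / 2) ^ 2)).const_sub 1
    simp only [zero_mul, zero_div, sub_zero] at e3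
    refine e3.congr fun n => ?_
    ring
  refine tendsto_of_tendsto_of_tendsto_of_le_of_le' hbound tendsto_const_nhds ?_ ?_
  · filter_upwards [eventually_gt_atTop ⌈(r : ℝ)⌉₊,
      (Metric.tendsto_nhds.1 ht1) (δ / 2) (by positivity),
      (Metric.tendsto_nhds.1 (tendsto_natCast_mul_log r)) δ hδ] with n hn h1 h2
    have hrn : (r : ℝ) < n := Nat.lt_of_ceil_lt hn
    have hn0 : (0 : ℝ) < n := hr'.trans hrn
    have hprob : IsProbabilityMeasure (binomialGraphOrderLaw r n) := by
      unfold binomialGraphOrderLaw; infer_instance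
    have hb := binomialGraphOrderLaw_real_le hrn (half_pos hδ)
    have hc := probReal_compl_eq_one_sub (μ := binomialGraphOrderLaw r n)
      (s := {x | δ / 2 ≤ |((n : ℝ) / (n - r)) ^ (greedyMIS x.1 (List.ofFn x.2)).ncard
          - (1 + n * (r / (n - r)))|}) .of_discrete
    refine (sub_le_sub_left hb 1).trans (hc.symm.le.trans (measureReal_mono ?_))
    intro x hx
    simp only [Set.mem_compl_iff, Set.mem_ofPred_eq, not_le] at hx ⊢
    have ha0 : 0 < (n : ℝ) / (n - r) := div_pos hn0 (sub_pos.2 hrn)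
    have hla : Real.log ((n : ℝ) / (n - r)) ≠ 0 := by
      refine (Real.log_pos ?_).ne'
      rw [one_lt_div (sub_pos.2 hrn)]; linarith
    -- Half of `δ` pays for the deviation from the mean, half for the distance of the mean from `1 +
    -- r`.
    have key := hδ' (x := (((n : ℝ) / (n - r)) ^ (greedyMIS x.1 (List.ofFn x.2)).ncard,
      (n : ℝ) * Real.log (n / (n - r)))) (by
        rw [Prod.dist_eq]
        refine max_lt ?_ h2
        calc _ ≤ dist _ (1 + n * ((r : ℝ) / (n - r))) + dist _ _ := dist_triangle _ _ _
          _ < δ / 2 + δ / 2 := add_lt_add (by simpa [Real.dist_eq] using hx) h1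
          _ = δ := by ring)
    simp only [Real.dist_eq, Real.log_pow] at key
    rw [mul_div_mul_right _ _ hla] at key
    exact key.le
  · refine .of_forall fun n => ?_
    have hprob : IsProbabilityMeasure (binomialGraphOrderLaw r n) := by
      unfold binomialGraphOrderLaw; infer_instance
    exact measureReal_le_one

/-! ### The greedy set in terms of pasts -/

section Past

variable {V : Type*} {G : SimpleGraph V} {s : V → unitInterval}

/-- Later vertices never affect membership, and along a sorted list "inspected earlier" means
"smaller label". -/
lemma mem_greedyMIS_iff {l : List V} (hl : l.Pairwise fun a b => s a < s b) {w : V} :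
    w ∈ greedyMIS G l ↔
      w ∈ l ∧ ∀ u ∈ l, s u < s w → G.Adj u w → u ∉ greedyMIS G l := by
  induction l using List.reverseRecOn generalizing w with
  | nil => simp [greedyMIS_nil]
  | append_singleton l a ih =>
    rw [List.pairwise_append] at hl
    have hla : ∀ u ∈ l, s u < s a := fun u hu => hl.2.2 u hu a (by simp)
    have hal : a ∉ l := fun h => lt_irrefl _ (hla a h)
    have hmem : ∀ u ∈ l, (u ∈ greedyMIS G (l ++ [a]) ↔ u ∈ greedyMIS G l) := by
      intro u hu
      rw [mem_greedyMIS_append_singleton]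
      have : u ≠ a := fun h => hal (h ▸ hu)
      simp [this]
    by_cases hw : w ∈ l
    · rw [hmem w hw, ih hl.1]
      constructor
      · rintro ⟨-, h⟩
        refine ⟨by simp [hw], fun u hu hlt hadj => ?_⟩
        rcases List.mem_append.1 hu with hu | hu
        · rw [hmem u hu]; exact h u hu hlt hadj
        · obtain rfl := List.mem_singleton.1 hu
          exact absurd hlt (hla w hw).asymm
      · rintro ⟨-, h⟩
        refine ⟨hw, fun u hu hlt hadj => ?_⟩
        rw [← hmem u hu]
        exact h u (by simp [hu]) hlt hadj
    · have hw' : w ∉ greedyMIS G l := fun h => hw (mem_of_mem_greedyMIS h)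
      rw [mem_greedyMIS_append_singleton]
      constructor
      · rintro (h | ⟨rfl, h⟩)
        · exact absurd h hw'
        · refine ⟨by simp, fun u hu hlt hadj => ?_⟩
          rcases List.mem_append.1 hu with hu | hu
          · rw [hmem u hu]; exact fun hg => h u hg hadj
          · obtain rfl := List.mem_singleton.1 hu
            exact absurd hlt (lt_irrefl _)
      · rintro ⟨h1, h⟩
        obtain rfl : w = a := by simpa [hw] using h1
        refine Or.inr ⟨rfl, fun u hu hadj => ?_⟩
        have hul := mem_of_mem_greedyMIS hu
        exact h u (by simp [hul]) (hla u hul) hadj ((hmem u hul).2 hu)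

/-- The greedy set restricted to a sublist that is closed under passing to earlier neighbours. -/
lemma mem_greedyMIS_iff_of_subset {l l' : List V} (hl : l.Pairwise fun a b => s a < s b)
    (hl' : l'.Pairwise fun a b => s a < s b) (hsub : ∀ u ∈ l', u ∈ l)
    (hclosed : ∀ w ∈ l', ∀ u ∈ l, s u < s w → G.Adj u w → u ∈ l') {w : V} (hw : w ∈ l') :
    w ∈ greedyMIS G l' ↔ w ∈ greedyMIS G l := by
  induction l' using List.reverseRecOn generalizing w with
  | nil => simp at hw
  | append_singleton l' a ih =>
    have hl'' := List.pairwise_append.1 hl'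
    have hla : ∀ u ∈ l', s u < s a := fun u hu => hl''.2.2 u hu a (by simp)
    have ih' : ∀ u ∈ l', (u ∈ greedyMIS G l' ↔ u ∈ greedyMIS G l) := by
      intro u hu
      refine ih hl''.1 (fun u hu => hsub u (by simp [hu])) (fun x hx y hy hlt hadj => ?_) hu
      rcases List.mem_append.1 (hclosed x (by simp [hx]) y hy hlt hadj) with h | h
      · exact h
      · obtain rfl := List.mem_singleton.1 h
        exact absurd hlt (hla x hx).asymm
    rcases List.mem_append.1 hw with hw | hw
    · rw [← ih' w hw, mem_greedyMIS_append_singleton]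
      have : w ≠ a := fun h => lt_irrefl (s a) (h ▸ hla w hw)
      simp [this]
    · obtain rfl := List.mem_singleton.1 hw
      rw [mem_greedyMIS_append_singleton, mem_greedyMIS_iff hl]
      have hwl : w ∉ greedyMIS G l' := fun h => lt_irrefl _ (hla w (mem_of_mem_greedyMIS h))
      constructor
      · rintro (h | ⟨-, h⟩)
        · exact absurd h hwl
        · refine ⟨hsub w (by simp), fun u hu hlt hadj hg => ?_⟩
          rcases List.mem_append.1 (hclosed w (by simp) u hu hlt hadj) with h' | h'
          · exact h u ((ih' u h').2 hg) hadj
          · obtain rfl := List.mem_singleton.1 h'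
            exact lt_irrefl _ hlt
      · rintro ⟨-, h⟩
        refine Or.inr ⟨rfl, fun u hu hadj => ?_⟩
        have hul := mem_of_mem_greedyMIS hu
        exact h u (hsub u (by simp [hul])) (hla u hul) hadj ((ih' u hul).1 hu)

lemma self_mem_past (v : V) : v ∈ past G s v := Relation.ReflTransGen.refl

lemma past_trans {u v w : V} (h : v ∈ past G s u) (h' : w ∈ past G s v) : w ∈ past G s u :=
  Relation.ReflTransGen.trans h h'

lemma mem_past_of_adj {u v : V} (h : G.Adj v u) (hs : s u < s v) : u ∈ past G s v :=
  Relation.ReflTransGen.single ⟨h, hs⟩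

lemma past_eq (v : V) :
    past G s v = insert v (⋃ u ∈ {u | G.Adj v u ∧ s u < s v}, past G s u) := by
  ext w
  simp only [Set.mem_insert_iff, Set.mem_iUnion, Set.mem_ofPred_eq, exists_prop]
  constructor
  · intro h
    rcases Relation.ReflTransGen.cases_head h with rfl | ⟨u, hu, h⟩
    · exact Or.inl rfl
    · exact Or.inr ⟨u, hu, h⟩
  · rintro (rfl | ⟨u, hu, h⟩)
    · exact self_mem_past _
    · exact past_trans (mem_past_of_adj hu.1 hu.2) h

lemma exists_sorted_list (hs : Function.Injective s) {A : Set V} (hA : A.Finite) :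
    ∃ l : List V, {v | v ∈ l} = A ∧ l.Pairwise fun a b => s a < s b := by
  classical
  rcases isEmpty_or_nonempty V with hV | hV
  · exact ⟨[], Subsingleton.elim _ _, .nil⟩
  let e : V ↪ unitInterval := ⟨s, hs⟩
  have h : ∀ x ∈ (hA.toFinset.map e).sort (· ≤ ·), ∃ v ∈ A, s v = x := by
    intro x hx
    simpa [e] using hx
  choose! f hfA hf using h
  refine ⟨((hA.toFinset.map e).sort (· ≤ ·)).map f, ?_, ?_⟩
  · ext v
    simp only [List.mem_map, Set.mem_ofPred_eq]
    constructor
    · rintro ⟨x, hx, rfl⟩; exact hfA x hx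
    · intro hv
      have hx : s v ∈ (hA.toFinset.map e).sort (· ≤ ·) := by simpa [e, hs.eq_iff] using hv
      exact ⟨s v, hx, hs (hf _ hx)⟩
  · rw [List.pairwise_map]
    refine List.Pairwise.imp_of_mem ?_ (Finset.sortedLT_sort (hA.toFinset.map e)).pairwise
    intro x y hx hy hxy
    rwa [hf x hx, hf y hy]

/-- A past is closed under earlier neighbours, so further inspected vertices cannot influence it.
One list can thus serve several roots. -/
lemma rootOccupied_iff_mem_greedyMIS {l : List V} {v : V} (hl : l.Pairwise fun a b => s a < s b)
    (hlv : ∀ u, u ∈ past G s v → u ∈ l) :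
    RootOccupied G s v ↔ v ∈ greedyMIS G l := by
  classical
  have key : ∀ l' : List V, {u | u ∈ l'} = past G s v → l'.Pairwise (fun a b => s a < s b) →
      (v ∈ greedyMIS G l' ↔ v ∈ greedyMIS G l) := by
    intro l' h1 h2
    have h3 : ∀ u, u ∈ l' ↔ u ∈ past G s v := fun u => Set.ext_iff.1 h1 u
    refine mem_greedyMIS_iff_of_subset hl h2 (fun u hu => hlv u ((h3 u).1 hu)) ?_
      ((h3 v).2 (self_mem_past v))
    intro w hw u _ hlt hadj
    rw [h3] at hw ⊢
    exact past_trans hw (mem_past_of_adj hadj.symm hlt)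
  constructor
  · rintro ⟨l', h1, h2, h3⟩
    exact (key l' h1 h2).1 h3
  · intro h
    have h1 : {u | u ∈ l.filter (· ∈ past G s v)} = past G s v := by
      ext u
      simpa using hlv u
    have h2 := hl.filter (fun u => decide (u ∈ past G s v))
    exact ⟨_, h1, h2, (key _ h1 h2).2 h⟩

/-- The recursive description of the greedy set: a vertex is occupied if and only if none of its
neighbours with smaller labels is. -/
lemma rootOccupied_iff (hs : Function.Injective s) {v : V} (hfin : (past G s v).Finite) :
    RootOccupied G s v ↔ ∀ u, G.Adj v u → s u < s v → ¬ RootOccupied G s u := by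
  obtain ⟨l, h1, h2⟩ := exists_sorted_list hs hfin
  have h3 : ∀ u, u ∈ l ↔ u ∈ past G s v := fun u => Set.ext_iff.1 h1 u
  -- The past of `u` lies in the past of `v`, so the list `l` decides every such `u`.
  have hocc : ∀ u ∈ past G s v, (RootOccupied G s u ↔ u ∈ greedyMIS G l) := fun u hu =>
    rootOccupied_iff_mem_greedyMIS h2 (fun w hw => (h3 w).2 (past_trans hu hw))
  rw [hocc v (self_mem_past v), mem_greedyMIS_iff h2]
  constructor
  · rintro ⟨-, h⟩ u hadj hlt
    have hu := mem_past_of_adj hadj hlt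
    rw [hocc u hu]
    exact h u ((h3 u).2 hu) hlt hadj.symm
  · intro h
    refine ⟨(h3 v).2 (self_mem_past v), fun u hu hlt hadj => ?_⟩
    rw [← hocc u ((h3 u).1 hu)]
    exact h u hadj.symm hlt

end Past

/-! ### Descents in family trees -/

section FamilyTree

variable {c : List ℕ → ℕ} {s : List ℕ → unitInterval}

/-- There is a path of `n` edges from `v` down the tree along which the labels decrease. -/
def HasDescent (c : List ℕ → ℕ) (s : List ℕ → unitInterval) : ℕ → List ℕ → Prop
  | 0, _ => True
  | n + 1, v => ∃ i, i < c v ∧ s (v ++ [i]) < s v ∧ HasDescent c s n (v ++ [i])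

/-- The greedy recursion on the tree below `v`, cut off at depth `n`. -/
def OccupiedToDepth (c : List ℕ → ℕ) (s : List ℕ → unitInterval) : ℕ → List ℕ → Prop
  | 0, _ => False
  | n + 1, v => ∀ i, i < c v → s (v ++ [i]) < s v → ¬ OccupiedToDepth c s n (v ++ [i])

lemma HasDescent.of_succ {n : ℕ} {v : List ℕ} (h : HasDescent c s (n + 1) v) :
    HasDescent c s n v := by
  induction n generalizing v with
  | zero => trivial
  | succ n ih =>
    obtain ⟨i, hi, hlt, h⟩ := h
    exact ⟨i, hi, hlt, ih h⟩

/-- `v` is a tree vertex whose label is smaller than that of its parent. -/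
def IsBelowParent (c : List ℕ → ℕ) (s : List ℕ → unitInterval) (v : List ℕ) : Prop :=
  IsTreeVertex c v ∧ ∀ u i, v = u ++ [i] → s v < s u

lemma isBelowParent_nil : IsBelowParent c s [] := ⟨.root, by simp⟩

lemma IsBelowParent.child {v : List ℕ} (h : IsBelowParent c s v) {i : ℕ} (hi : i < c v)
    (hlt : s (v ++ [i]) < s v) : IsBelowParent c s (v ++ [i]) := by
  refine ⟨.child h.1 hi, fun u j hu => ?_⟩
  obtain ⟨rfl, -⟩ := List.append_inj' hu rfl
  exact hlt

/-- The parent has a larger label, so a decreasing step can only lead to a child. -/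
lemma IsBelowParent.adj_iff {v w : List ℕ} (h : IsBelowParent c s v) :
    ((familyTree c).Adj v w ∧ s w < s v) ↔ ∃ i, i < c v ∧ s (v ++ [i]) < s v ∧ w = v ++ [i] := by
  simp only [familyTree, SimpleGraph.fromRel_adj]
  constructor
  · rintro ⟨⟨-, ⟨-, i, hi, rfl⟩ | ⟨-, i, -, hw⟩⟩, hlt⟩
    · exact ⟨i, hi, hlt, rfl⟩
    · exact absurd hlt (h.2 w i hw).asymm
  · rintro ⟨i, hi, hlt, rfl⟩
    exact ⟨⟨by simp, Or.inl ⟨h.1, i, hi, rfl⟩⟩, hlt⟩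

/-- The past is finitely branching and of bounded depth. -/
lemma IsBelowParent.past_finite {n : ℕ} {v : List ℕ} (h : IsBelowParent c s v)
    (hn : ¬ HasDescent c s n v) : (past (familyTree c) s v).Finite := by
  induction n generalizing v with
  | zero => exact absurd trivial hn
  | succ n ih =>
    rw [past_eq]
    refine Set.Finite.insert _ (Set.Finite.biUnion ?_ fun u hu => ?_)
    · refine ((Set.finite_lt_nat (c v)).image fun i => v ++ [i]).subset fun u hu => ?_
      obtain ⟨i, hi, -, rfl⟩ := h.adj_iff.1 hu
      exact ⟨i, hi, rfl⟩
    · obtain ⟨i, hi, hlt, rfl⟩ := h.adj_iff.1 hu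
      exact ih (h.child hi hlt) fun hd => hn ⟨i, hi, hlt, hd⟩

/-- Without a descent of `n` edges the recursion ends before the cutoff, so the value `False` at
depth `0` is never consulted. -/
lemma IsBelowParent.rootOccupied_iff_occupiedToDepth (hs : Function.Injective s) {n : ℕ}
    {v : List ℕ} (h : IsBelowParent c s v) (hn : ¬ HasDescent c s n v) :
    RootOccupied (familyTree c) s v ↔ OccupiedToDepth c s n v := by
  induction n generalizing v with
  | zero => exact absurd trivial hn
  | succ n ih =>
    rw [rootOccupied_iff hs (h.past_finite hn)]
    have ih' : ∀ i, i < c v → s (v ++ [i]) < s v →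
        (RootOccupied (familyTree c) s (v ++ [i]) ↔ OccupiedToDepth c s n (v ++ [i])) :=
      fun i hi hlt => ih (h.child hi hlt) fun hd => hn ⟨i, hi, hlt, hd⟩
    constructor
    · intro H i hi hlt
      rw [← ih' i hi hlt]
      obtain ⟨hadj, -⟩ := h.adj_iff.2 ⟨i, hi, hlt, rfl⟩
      exact H _ hadj hlt
    · intro H u hadj hlt
      obtain ⟨i, hi, hlt, rfl⟩ := h.adj_iff.1 ⟨hadj, hlt⟩
      rw [ih' i hi hlt]
      exact H i hi hlt

end FamilyTree

/-! ### Measurability of the past -/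

section Measurability

variable {V : Type*} [Countable V]

lemma measurableSet_mem_past (v w : V) :
    MeasurableSet {p : SimpleGraph V × (V → unitInterval) | w ∈ past p.1 p.2 v} := by
  let R : SimpleGraph V × (V → unitInterval) → V → V → Prop :=
    fun p a b => p.1.Adj a b ∧ p.2 b < p.2 a
  -- `S n w`: some decreasing walk of exactly `n` steps leads from `v` to `w`.
  let S : ℕ → V → Set (SimpleGraph V × (V → unitInterval)) := fun n =>
    Nat.rec (fun w => {_p | w = v}) (fun _ T w => ⋃ u, T u ∩ {p | R p u w}) n
  have hS : ∀ n w, MeasurableSet (S n w) := by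
    intro n
    induction n with
    | zero => exact fun w => .const _
    | succ n ih =>
      refine fun w => .iUnion fun u => (ih u).inter ?_
      refine .inter (measurableSet_setOfPred.2 (by fun_prop)) (measurableSet_lt ?_ ?_) <;> fun_prop
  have h : {p : SimpleGraph V × (V → unitInterval) | w ∈ past p.1 p.2 v} = ⋃ n, S n w := by
    ext p
    simp only [Set.mem_ofPred_eq, Set.mem_iUnion]
    constructor
    · intro h
      change Relation.ReflTransGen (R p) v w at h
      induction h with
      | refl => exact ⟨0, rfl⟩
      | @tail b c _ hbc ih =>
        obtain ⟨n, hn⟩ := ih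
        exact ⟨n + 1, Set.mem_iUnion.2 ⟨b, hn, hbc⟩⟩
    · rintro ⟨n, hn⟩
      induction n generalizing w with
      | zero =>
        obtain rfl : w = v := hn
        exact self_mem_past w
      | succ n ih =>
        obtain ⟨u, hu, huw⟩ := Set.mem_iUnion.1 hn
        exact Relation.ReflTransGen.tail (ih u hu) huw
  rw [h]
  exact .iUnion fun n => hS n w

lemma measurableSet_finite_past (v : V) :
    MeasurableSet {p : SimpleGraph V × (V → unitInterval) | (past p.1 p.2 v).Finite} := by
  have h : {p : SimpleGraph V × (V → unitInterval) | (past p.1 p.2 v).Finite} =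
      ⋃ F : Finset V, ⋂ w : V, {p | w ∈ past p.1 p.2 v → w ∈ F} := by
    ext p
    simp only [Set.mem_ofPred_eq, Set.mem_iUnion, Set.mem_iInter]
    constructor
    · intro h
      exact ⟨h.toFinset, fun w hw => h.mem_toFinset.2 hw⟩
    · rintro ⟨F, hF⟩
      exact F.finite_toSet.subset fun w hw => hF w hw
  rw [h]
  refine .iUnion fun F => .iInter fun w => measurableSet_setOfPred.2 ?_
  exact .imp (measurableSet_setOfPred.1 (measurableSet_mem_past v w)) measurable_const

lemma measurableSet_mem_greedyMIS (l : List V) (w : V) :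
    MeasurableSet {G : SimpleGraph V | w ∈ greedyMIS G l} := by
  induction l using List.reverseRecOn generalizing w with
  | nil => simp [greedyMIS_nil]
  | append_singleton l a ih =>
    simp only [mem_greedyMIS_append_singleton]
    refine measurableSet_setOfPred.2 (.or (measurableSet_setOfPred.1 (ih w))
      (.and measurable_const (.forall fun u => .imp (measurableSet_setOfPred.1 (ih u)) ?_)))
    exact .not (by fun_prop)

lemma measurableSet_rootOccupied (v : V) :
    MeasurableSet {p : SimpleGraph V × (V → unitInterval) | RootOccupied p.1 p.2 v} := by
  simp only [RootOccupied, Set.ext_iff, List.pairwise_iff_getElem]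
  refine measurableSet_setOfPred.2 (.exists fun l => .and (.forall fun w => ?_) (.and ?_ ?_))
  · exact .iff measurable_const (measurableSet_setOfPred.1 (measurableSet_mem_past v w))
  · refine .forall fun i => .forall fun j => .forall fun _ => .forall fun _ => .forall fun _ => ?_
    exact measurableSet_setOfPred.1 (measurableSet_lt (by fun_prop) (by fun_prop))
  · exact (measurableSet_setOfPred.1 (measurableSet_mem_greedyMIS l v)).comp measurable_fst

end Measurability

/-! ### The law of labelled Galton–Watson trees -/

section ProductMeasures

/-- Infinite products are determined by their finite marginals, where this is the finite product
identity. -/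
lemma infinitePi_prod_map_zip {ι α β : Type*} [MeasurableSpace α] [MeasurableSpace β]
    (μ : ι → Measure α) (ν : ι → Measure β) [∀ i, IsProbabilityMeasure (μ i)]
    [∀ i, IsProbabilityMeasure (ν i)] :
    ((Measure.infinitePi μ).prod (Measure.infinitePi ν)).map (fun p i => (p.1 i, p.2 i)) =
      Measure.infinitePi fun i => (μ i).prod (ν i) := by
  refine ((Measure.isProjectiveLimit_infinitePi _).unique fun I => ?_).symm
  rw [Measure.map_map (by fun_prop) (by fun_prop)]
  have h := (measurePreserving_arrowProdEquivProdArrow α β I (fun i => μ i) (fun i => ν i)).symm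
  have h2 := h.map_eq
  rw [← Measure.infinitePi_map_restrict, ← Measure.infinitePi_map_restrict,
    Measure.map_prod_map _ _ (by fun_prop) (by fun_prop),
    Measure.map_map (by fun_prop) (by fun_prop)] at h2
  exact h2

lemma infinitePi_map_unzip {ι α β : Type*} [MeasurableSpace α] [MeasurableSpace β]
    (μ : ι → Measure α) (ν : ι → Measure β) [∀ i, IsProbabilityMeasure (μ i)]
    [∀ i, IsProbabilityMeasure (ν i)] :
    (Measure.infinitePi fun i => (μ i).prod (ν i)).map
        (fun ω => ((fun i => (ω i).1), fun i => (ω i).2)) =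
      (Measure.infinitePi μ).prod (Measure.infinitePi ν) := by
  rw [← infinitePi_prod_map_zip, Measure.map_map (by fun_prop) (by fun_prop)]
  exact Measure.map_id

/-- Independent identically distributed variables on the vertices of the tree of all finite
sequences: the variable at the root and the families on the subtrees of the children of the root. -/
lemma infinitePi_list_map_split {α : Type*} [MeasurableSpace α] (ν : Measure α)
    [IsProbabilityMeasure ν] :
    (Measure.infinitePi fun _ : List ℕ => ν).map
        (fun ω => (ω [], fun (i : ℕ) (u : List ℕ) => ω (i :: u))) =
      ν.prod (Measure.infinitePi fun _ : ℕ => Measure.infinitePi fun _ : List ℕ => ν) := by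
  classical
  have hi : iIndepFun (fun (v : List ℕ) (ω : List ℕ → α) => ω v)
      (Measure.infinitePi fun _ : List ℕ => ν) :=
    iIndepFun_infinitePi (X := fun _ x => x) fun _ => measurable_id
  have hind : IndepFun (fun ω : List ℕ → α => ω [])
      (fun ω (p : ℕ × List ℕ) => ω (p.1 :: p.2)) (Measure.infinitePi fun _ : List ℕ => ν) := by
    refine IndepFun.indepFun_process (by fun_prop) (fun _ => by fun_prop) fun J => ?_
    have hd : Disjoint ({[]} : Finset (List ℕ)) (J.image fun p => p.1 :: p.2) := by simp
    have hφ : Measurable fun x : ({[]} : Finset (List ℕ)) → α => x ⟨[], by simp⟩ :=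
      measurable_pi_apply _
    have hψ : Measurable fun (x : (J.image fun p => p.1 :: p.2) → α) (p : J) =>
        x ⟨p.1.1 :: p.1.2, Finset.mem_image_of_mem _ p.2⟩ :=
      measurable_pi_lambda _ fun _ => measurable_pi_apply _
    exact (hi.indepFun_finset _ _ hd fun v => measurable_pi_apply v).comp hφ hψ
  have hmap := hind.map_prod_eq_prod_map_map (measurable_pi_apply _).aemeasurable
    (measurable_pi_lambda _ fun _ => measurable_pi_apply _).aemeasurable
  -- The non-root variables are i.i.d. over `ℕ × List ℕ`; currying groups them by child.
  have hinj : Function.Injective fun p : ℕ × List ℕ => p.1 :: p.2 := by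
    rintro ⟨a, b⟩ ⟨c, d⟩ h
    simpa using h
  rw [Measure.infinitePi_map_eval (fun _ : List ℕ => ν) [],
    Measure.map_infinitePi_infinitePi_of_inj hinj] at hmap
  have hc := Measure.infinitePi_map_curry (fun (_ : ℕ) (_ : List ℕ) => ν)
  have hprod := Measure.map_prod_map ν (Measure.infinitePi fun _ : ℕ × List ℕ => ν)
    measurable_id (MeasurableEquiv.curry ℕ (List ℕ) α).measurable
  rw [Measure.map_id, hc, ← hmap, Measure.map_map (by fun_prop) (by fun_prop)] at hprod
  rw [hprod]
  rfl

end ProductMeasures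

/-! ### The recursion at the root of the Galton–Watson tree -/

section Recursion

/-- The law of the labelled family tree: at every vertex a Poisson number of children and
a uniform label. -/
def labelledTreeLaw (r : ℝ≥0) : Measure (List ℕ → ℕ × unitInterval) :=
  Measure.infinitePi fun _ => (poissonMeasure r).prod volume

instance (r : ℝ≥0) : IsProbabilityMeasure (labelledTreeLaw r) := by
  unfold labelledTreeLaw; infer_instance

/-- The number of children at each vertex. -/
def childCount (ω : List ℕ → ℕ × unitInterval) : List ℕ → ℕ := fun v => (ω v).1

/-- The label of each vertex. -/
def vertexLabel (ω : List ℕ → ℕ × unitInterval) : List ℕ → unitInterval := fun v => (ω v).2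

/-- The data of the subtree of the `i`-th child of the root. -/
def subtree (ω : List ℕ → ℕ × unitInterval) (i : ℕ) : List ℕ → ℕ × unitInterval :=
  fun u => ω (i :: u)

/-- Moves everything to a single product measure, which splits at the root. -/
lemma poissonGW_prod_labelLaw (r : ℝ≥0) :
    (poissonGW r).prod (labelLaw (List ℕ)) =
      (labelledTreeLaw r).map fun ω => (familyTree (childCount ω), vertexLabel ω) := by
  have h := Measure.map_prod_map (Measure.infinitePi fun _ : List ℕ => poissonMeasure r)
    (labelLaw (List ℕ)) measurable_familyTree measurable_id
  rw [Measure.map_id] at h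
  rw [poissonGW, h, labelLaw, ← infinitePi_map_unzip, Measure.map_map]
  · rfl
  · exact measurable_familyTree.prodMap measurable_id
  · fun_prop

lemma measurable_labelledTree :
    Measurable fun ω : List ℕ → ℕ × unitInterval =>
      (familyTree (childCount ω), vertexLabel ω) := by
  unfold childCount vertexLabel
  exact (measurable_familyTree.comp (by fun_prop)).prodMk (by fun_prop)

/-- The probability that the event `A` holds and that the label of the root is less than `t`. -/
def probBelow (r : ℝ≥0) (A : Set (List ℕ → ℕ × unitInterval)) (t : ℝ) : ℝ :=
  (labelledTreeLaw r).real {ω | (vertexLabel ω [] : ℝ) < t ∧ ω ∈ A}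

lemma probBelow_le_one (r : ℝ≥0) (A : Set (List ℕ → ℕ × unitInterval)) (t : ℝ) :
    probBelow r A t ≤ 1 := measureReal_le_one

lemma probBelow_mono (r : ℝ≥0) (A : Set (List ℕ → ℕ × unitInterval)) :
    Monotone (probBelow r A) := fun _ _ h =>
  measureReal_mono fun _ hω => ⟨hω.1.trans_le h, hω.2⟩

lemma measurable_probBelow (r : ℝ≥0) (A : Set (List ℕ → ℕ × unitInterval)) :
    Measurable (probBelow r A) := (probBelow_mono r A).measurable

lemma measurableSet_inter_vertexLabel_lt {A : Set (List ℕ → ℕ × unitInterval)}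
    (hA : MeasurableSet A) (t : ℝ) :
    MeasurableSet {ω | (vertexLabel ω [] : ℝ) < t ∧ ω ∈ A} := by
  have h : Measurable fun ω : List ℕ → ℕ × unitInterval => (vertexLabel ω [] : ℝ) := by
    unfold vertexLabel; fun_prop
  exact (measurableSet_lt h measurable_const).inter hA

/-- The probability generating function of the Poisson distribution. -/
lemma lintegral_pow_poissonMeasure (r : ℝ≥0) {y : ℝ} (hy : 0 ≤ y) :
    ∫⁻ k, ENNReal.ofReal y ^ k ∂(poissonMeasure r) = ENNReal.ofReal (Real.exp (-r * (1 - y))) := by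
  have hsum : HasSum (fun k : ℕ => y ^ k * (Real.exp (-r) * r ^ k / k.factorial))
      (Real.exp (-r * (1 - y))) := by
    have h := (NormedSpace.expSeries_div_hasSum_exp ((r : ℝ) * y)).mul_left (Real.exp (-r))
    rw [← Real.exp_eq_exp_ℝ, ← Real.exp_add] at h
    convert! h using 1
    · ext k; rw [mul_pow]; ring
    · congr 1; ring
  rw [lintegral_countable']
  simp_rw [poissonMeasure_singleton, ← ENNReal.ofReal_pow hy]
  simp_rw [← ENNReal.ofReal_mul (pow_nonneg hy _)]
  rw [← ENNReal.ofReal_tsum_of_nonneg _ hsum.summable, hsum.tsum_eq]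
  intro k
  positivity

/-- Given the root, the subtrees of its children are independent copies of the tree. -/
theorem probBelow_forall_not (r : ℝ≥0) {A : Set (List ℕ → ℕ × unitInterval)}
    (hA : MeasurableSet A) {t : ℝ} (ht0 : 0 ≤ t) (ht1 : t ≤ 1) :
    probBelow r {ω | ∀ i < childCount ω [],
        ¬ (vertexLabel ω [i] < vertexLabel ω [] ∧ subtree ω i ∈ A)} t =
      ∫ u in (0 : ℝ)..t, Real.exp (-r * probBelow r A u) := by
  set M := labelledTreeLaw r with hM
  let B : ℝ → Set (List ℕ → ℕ × unitInterval) := fun u => {ω | (vertexLabel ω [] : ℝ) < u ∧ ω ∈ A}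
  have hB : ∀ u, MeasurableSet (B u) := fun u => measurableSet_inter_vertexLabel_lt hA u
  let E : Set ((ℕ × unitInterval) × (ℕ → List ℕ → ℕ × unitInterval)) :=
    {p | (p.1.2 : ℝ) < t ∧ ∀ i < p.1.1, ¬ (((p.2 i []).2 : ℝ) < p.1.2 ∧ p.2 i ∈ A)}
  have hE : MeasurableSet E := by
    refine measurableSet_setOfPred.2 (.and ?_ (.forall fun i => .imp ?_ (.not (.and ?_ ?_))))
    · exact measurableSet_setOfPred.1 (measurableSet_lt (by fun_prop) measurable_const)
    · exact measurableSet_setOfPred.1 (measurableSet_lt measurable_const (by fun_prop))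
    · exact measurableSet_setOfPred.1 (measurableSet_lt (by fun_prop) (by fun_prop))
    · exact measurableSet_setOfPred.1 (hA.preimage (by fun_prop))
  have hsplit := infinitePi_list_map_split ((poissonMeasure r).prod (volume : Measure unitInterval))
  have h1 : probBelow r {ω | ∀ i < childCount ω [],
      ¬ (vertexLabel ω [i] < vertexLabel ω [] ∧ subtree ω i ∈ A)} t =
      ((((poissonMeasure r).prod volume).prod (Measure.infinitePi fun _ : ℕ => M)) E).toReal := by
    rw [hM, labelledTreeLaw, ← hsplit, Measure.map_apply (by fun_prop) hE]
    rfl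
  -- Given `k` children and root label `u < t`, each child independently avoids the bad event with
  -- probability `1 - probBelow r A u`.
  have hsec : ∀ x : ℕ × unitInterval, (Measure.infinitePi fun _ : ℕ => M) (Prod.mk x ⁻¹' E) =
      (Set.Iio t).indicator (fun u : ℝ => ENNReal.ofReal (1 - probBelow r A u) ^ x.1) x.2 := by
    intro x
    by_cases hx : (x.2 : ℝ) < t
    · have : Prod.mk x ⁻¹' E = Set.pi (Finset.range x.1) fun _ => (B x.2)ᶜ := by
        ext f
        simp [E, B, hx, vertexLabel]
      rw [this, Measure.infinitePi_pi _ fun _ _ => (hB _).compl, Set.indicator_of_mem (by exact hx)]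
      have hc : M (B x.2)ᶜ = ENNReal.ofReal (1 - probBelow r A x.2) := by
        rw [show probBelow r A x.2 = M.real (B x.2) from rfl, ← probReal_compl_eq_one_sub (hB x.2),
          ofReal_measureReal]
      simp [hc]
    · have : Prod.mk x ⁻¹' E = ∅ := by
        ext f
        simp [E, hx]
      rw [this, Set.indicator_of_notMem (by exact hx), measure_empty]
  have hmeas : Measurable fun x : ℕ × unitInterval =>
      (Set.Iio t).indicator (fun u : ℝ => ENNReal.ofReal (1 - probBelow r A u) ^ x.1) x.2 := by
    simp_rw [← hsec]
    exact measurable_measure_prodMk_left hE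
  -- Averaging the `k`-th power over the Poisson number of children yields the exponential.
  have hinner : ∀ u : unitInterval, ∫⁻ k,
      (Set.Iio t).indicator (fun u : ℝ => ENNReal.ofReal (1 - probBelow r A u) ^ k) u
        ∂(poissonMeasure r) = ENNReal.ofReal
          ((Set.Iio t).indicator (fun u : ℝ => Real.exp (-r * probBelow r A u)) u) := by
    intro u
    by_cases hu : (u : ℝ) < t
    · simp only [Set.indicator_of_mem (show (u : ℝ) ∈ Set.Iio t from hu)]
      rw [lintegral_pow_poissonMeasure r (sub_nonneg.2 (probBelow_le_one r A u))]
      simp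
    · simp [Set.indicator_of_notMem (show (u : ℝ) ∉ Set.Iio t from hu)]
  have hcont : Measurable ((Set.Iio t).indicator fun u : ℝ => Real.exp (-r * probBelow r A u)) :=
    (Real.measurable_exp.comp ((measurable_probBelow r A).const_mul _)).indicator measurableSet_Iio
  rw [h1, Measure.prod_apply hE]
  simp_rw [hsec]
  rw [lintegral_prod_symm _ hmeas.aemeasurable]
  simp_rw [hinner]
  rw [← integral_eq_lintegral_of_nonneg_ae
    (.of_forall fun u => Set.indicator_nonneg (fun _ _ => (Real.exp_pos _).le) _)
    (hcont.comp measurable_subtype_coe).aestronglyMeasurable,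
    unitInterval.measurePreserving_coe.integral_comp unitInterval.measurableEmbedding_coe,
    setIntegral_indicator measurableSet_Iio, intervalIntegral.integral_of_le ht0,
    ← integral_Ico_eq_integral_Ioc]
  congr 2
  ext u
  simp only [Set.mem_inter_iff, Set.mem_Icc, Set.mem_Iio, Set.mem_Ico]
  constructor
  · rintro ⟨⟨h, -⟩, h'⟩; exact ⟨h, h'⟩
  · rintro ⟨h, h'⟩; exact ⟨⟨h, h'.le.trans ht1⟩, h'⟩

lemma labelledTreeLaw_vertexLabel_eq (r : ℝ≥0) (v : List ℕ) (x : unitInterval) :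
    ∀ᵐ ω ∂(labelledTreeLaw r), vertexLabel ω v ≠ x := by
  have h := measurePreserving_eval_infinitePi
    (fun _ : List ℕ => (poissonMeasure r).prod (volume : Measure unitInterval)) v
  refine h.quasiMeasurePreserving.ae (p := fun y => y.2 ≠ x) ?_
  rw [ae_iff]
  have : {a : ℕ × unitInterval | ¬ a.2 ≠ x} = Set.univ ×ˢ {x} := by ext; simp
  rw [this, Measure.prod_prod]
  simp

lemma probBelow_one (r : ℝ≥0) (A : Set (List ℕ → ℕ × unitInterval)) :
    probBelow r A 1 = (labelledTreeLaw r).real A := by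
  refine measureReal_congr ?_
  filter_upwards [labelledTreeLaw_vertexLabel_eq r [] 1] with ω hω
  refine propext ⟨fun h => h.2, fun h => ⟨?_, h⟩⟩
  exact lt_of_le_of_ne (vertexLabel ω []).2.2 fun he => hω (Subtype.ext he)

/-- The case `A = ∅` of `probBelow_forall_not`: the event is everything and the integrand is `1`. -/
lemma probBelow_univ (r : ℝ≥0) {t : ℝ} (ht0 : 0 ≤ t) (ht1 : t ≤ 1) :
    probBelow r Set.univ t = t := by
  have h := probBelow_forall_not r MeasurableSet.empty ht0 ht1
  simpa [probBelow] using h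

lemma ae_injective_vertexLabel (r : ℝ≥0) :
    ∀ᵐ ω ∂(labelledTreeLaw r), Function.Injective (vertexLabel ω) := by
  have h : ∀ v w : List ℕ, v ≠ w → ∀ᵐ ω ∂(labelledTreeLaw r), vertexLabel ω v ≠ vertexLabel ω w := by
    intro v w hvw
    have hp : MeasurePreserving (fun ω : List ℕ → ℕ × unitInterval => (ω v, ω w))
        (labelledTreeLaw r) (((poissonMeasure r).prod volume).prod
          ((poissonMeasure r).prod volume)) :=
      ⟨by fun_prop, Measure.infinitePi_map_eval_prod hvw⟩
    refine hp.quasiMeasurePreserving.ae (p := fun y => y.1.2 ≠ y.2.2) ?_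
    rw [ae_iff, Measure.measure_prod_null]
    · refine .of_forall fun x => ?_
      have : Prod.mk x ⁻¹' {a : (ℕ × unitInterval) × (ℕ × unitInterval) | ¬ a.1.2 ≠ a.2.2} =
          Set.univ ×ˢ {x.2} := by ext; simp [eq_comm]
      change ((poissonMeasure r).prod volume) (Prod.mk x ⁻¹' _) = 0
      rw [this, Measure.prod_prod]
      simp
    · simp only [ne_eq, not_not]
      exact measurableSet_eq_fun (by fun_prop) (by fun_prop)
  have h' : ∀ᵐ ω ∂(labelledTreeLaw r), ∀ v w : List ℕ, v ≠ w →
      vertexLabel ω v ≠ vertexLabel ω w := by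
    simp only [ae_all_iff]
    exact h
  filter_upwards [h'] with ω hω v w hvw
  by_contra hne
  exact hω v w hne hvw

end Recursion

/-! ### Nonexplosive growth and the root density of the Galton–Watson tree -/

section GaltonWatson

lemma hasDescent_cons_iff (c : List ℕ → ℕ) (s : List ℕ → unitInterval) (n i : ℕ) (v : List ℕ) :
    HasDescent c s n (i :: v) ↔ HasDescent (fun u => c (i :: u)) (fun u => s (i :: u)) n v := by
  induction n generalizing v with
  | zero => exact Iff.rfl
  | succ n ih => simp only [HasDescent, List.cons_append, ih]

lemma occupiedToDepth_cons_iff (c : List ℕ → ℕ) (s : List ℕ → unitInterval) (n i : ℕ)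
    (v : List ℕ) : OccupiedToDepth c s n (i :: v) ↔
      OccupiedToDepth (fun u => c (i :: u)) (fun u => s (i :: u)) n v := by
  induction n generalizing v with
  | zero => exact Iff.rfl
  | succ n ih => simp only [OccupiedToDepth, List.cons_append, ih]

/-- The event that there is a descent of length `n` from the root. -/
def descentEvent (n : ℕ) : Set (List ℕ → ℕ × unitInterval) :=
  {ω | HasDescent (childCount ω) (vertexLabel ω) n []}

/-- The event that the root is occupied. -/
def occupiedEvent : Set (List ℕ → ℕ × unitInterval) :=
  {ω | RootOccupied (familyTree (childCount ω)) (vertexLabel ω) []}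

lemma descentEvent_succ (n : ℕ) :
    descentEvent (n + 1) = {ω | ∀ i < childCount ω [],
      ¬ (vertexLabel ω [i] < vertexLabel ω [] ∧ subtree ω i ∈ descentEvent n)}ᶜ := by
  ext ω
  simp only [descentEvent, HasDescent, List.nil_append, hasDescent_cons_iff, Set.mem_ofPred_eq,
    Set.mem_compl_iff, not_forall, not_not, exists_prop]
  rfl

lemma measurableSet_descentEvent (n : ℕ) : MeasurableSet (descentEvent n) := by
  induction n with
  | zero => exact MeasurableSet.univ
  | succ n ih =>
    rw [descentEvent_succ]
    refine MeasurableSet.compl (measurableSet_setOfPred.2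
      (.forall fun i => .imp ?_ (.not (.and ?_ ?_))))
    · unfold childCount
      exact measurableSet_setOfPred.1 (measurableSet_lt measurable_const (by fun_prop))
    · unfold vertexLabel
      exact measurableSet_setOfPred.1 (measurableSet_lt (by fun_prop) (by fun_prop))
    · unfold subtree
      exact measurableSet_setOfPred.1 (ih.preimage (by fun_prop))

lemma measurableSet_occupiedEvent : MeasurableSet occupiedEvent :=
  (measurableSet_rootOccupied []).preimage measurable_labelledTree

lemma probBelow_add_compl (r : ℝ≥0) {A : Set (List ℕ → ℕ × unitInterval)} (hA : MeasurableSet A)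
    {t : ℝ} (ht0 : 0 ≤ t) (ht1 : t ≤ 1) : probBelow r A t + probBelow r Aᶜ t = t := by
  conv_rhs => rw [← probBelow_univ r ht0 ht1]
  have h := measureReal_inter_add_sdiff (μ := labelledTreeLaw r)
    (s := {ω | (vertexLabel ω [] : ℝ) < t ∧ ω ∈ Set.univ}) hA
  rw [probBelow, probBelow, probBelow, ← h]
  congr 2 <;> ext ω <;> simp

lemma intervalIntegrable_exp_probBelow (r : ℝ≥0) (A : Set (List ℕ → ℕ × unitInterval)) (a b : ℝ) :
    IntervalIntegrable (fun u => Real.exp (-r * probBelow r A u)) volume a b := by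
  refine Antitone.intervalIntegrable fun x y h => Real.exp_le_exp.2 ?_
  have := mul_le_mul_of_nonneg_left (probBelow_mono r A h) r.2
  simp only [neg_mul, neg_le_neg_iff]
  exact this

/-- The complement formula and `exp (-x) ≥ 1 - x` bound each probability by `r` times the integral
of the previous one. -/
lemma probBelow_descentEvent_le (r : ℝ≥0) (n : ℕ) {t : ℝ} (ht0 : 0 ≤ t) (ht1 : t ≤ 1) :
    probBelow r (descentEvent n) t ≤ (r : ℝ) ^ n * t ^ (n + 1) / (n + 1).factorial := by
  induction n generalizing t with
  | zero =>
    have : descentEvent 0 = Set.univ := rfl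
    rw [this, probBelow_univ r ht0 ht1]
    simp
  | succ n ih =>
    have h := probBelow_add_compl r (measurableSet_descentEvent (n + 1)) ht0 ht1
    rw [descentEvent_succ, compl_compl,
      probBelow_forall_not r (measurableSet_descentEvent n) ht0 ht1, ← descentEvent_succ] at h
    have hle : ∫ u in (0 : ℝ)..t, (1 - (r : ℝ) ^ (n + 1) / (n + 1).factorial * u ^ (n + 1)) ≤
        ∫ u in (0 : ℝ)..t, Real.exp (-r * probBelow r (descentEvent n) u) := by
      refine intervalIntegral.integral_mono_on ht0 (Continuous.intervalIntegrable (by fun_prop) _ _)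
        (intervalIntegrable_exp_probBelow r _ _ _) fun u hu => ?_
      have h1 := Real.add_one_le_exp (-r * probBelow r (descentEvent n) u)
      have h2 := mul_le_mul_of_nonneg_left (ih hu.1 (hu.2.trans ht1)) r.2
      have h3 : (r : ℝ) * ((r : ℝ) ^ n * u ^ (n + 1) / (n + 1).factorial) =
        (r : ℝ) ^ (n + 1) / (n + 1).factorial * u ^ (n + 1) := by ring
      change (r : ℝ) * _ ≤ (r : ℝ) * _ at h2
      linarith
    rw [intervalIntegral.integral_sub (by simp) (Continuous.intervalIntegrable (by fun_prop) _ _),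
      intervalIntegral.integral_const_mul, integral_pow] at hle
    have h4 : (r : ℝ) ^ (n + 1) / (n + 1).factorial *
        ((t ^ (n + 1 + 1) - 0 ^ (n + 1 + 1)) / ((n + 1 : ℕ) + 1)) =
        (r : ℝ) ^ (n + 1) * t ^ (n + 1 + 1) / (n + 1 + 1).factorial := by
      rw [Nat.factorial_succ (n + 1)]
      push_cast
      field_simp
      simp
    rw [h4] at hle
    simp only [intervalIntegral.integral_const, smul_eq_mul] at hle
    linarith

lemma ae_exists_not_hasDescent (r : ℝ≥0) :
    ∀ᵐ ω ∂(labelledTreeLaw r), ∃ n, ¬ HasDescent (childCount ω) (vertexLabel ω) n [] := by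
  have hle : ∀ n : ℕ, (labelledTreeLaw r).real (⋂ n, descentEvent n) ≤ (r : ℝ) ^ n / n.factorial := by
    intro n
    refine (measureReal_mono (Set.iInter_subset _ n)).trans ?_
    rw [← probBelow_one]
    refine (probBelow_descentEvent_le r n zero_le_one le_rfl).trans ?_
    rw [one_pow, mul_one]
    gcongr
    exact Nat.le_succ n
  have h0 : (labelledTreeLaw r).real (⋂ n, descentEvent n) = 0 :=
    le_antisymm (ge_of_tendsto' (FloorSemiring.tendsto_pow_div_factorial_atTop (r : ℝ)) hle)
      measureReal_nonneg
  rw [measureReal_eq_zero_iff] at h0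
  filter_upwards [measure_eq_zero_iff_ae_notMem.1 h0] with ω hω
  by_contra! h
  exact hω (Set.mem_iInter.2 h)

theorem nonexplosiveGrowth_poissonGW (r : ℝ≥0) : NonexplosiveGrowth (poissonGW r) [] := by
  rw [NonexplosiveGrowth, poissonGW_prod_labelLaw,
    ae_map_iff measurable_labelledTree.aemeasurable (measurableSet_finite_past [])]
  filter_upwards [ae_exists_not_hasDescent r] with ω ⟨n, hn⟩
  exact isBelowParent_nil.past_finite hn

/-- `RootOccupied` refers to the whole graph, but the truncated recursion sees only descendants and
so passes to subtrees; it serves as the intermediary. -/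
lemma occupiedEvent_ae_eq (r : ℝ≥0) :
    ∀ᵐ ω ∂(labelledTreeLaw r), ω ∈ occupiedEvent ↔ ∀ i < childCount ω [],
      ¬ (vertexLabel ω [i] < vertexLabel ω [] ∧ subtree ω i ∈ occupiedEvent) := by
  filter_upwards [ae_exists_not_hasDescent r, ae_injective_vertexLabel r] with ω ⟨n, hn⟩ hinj
  -- Depth `n + 1` leaves depth `n` for the children after one unfolding.
  have hn' : ¬ HasDescent (childCount ω) (vertexLabel ω) (n + 1) [] := fun h => hn h.of_succ
  rw [occupiedEvent, Set.mem_ofPred_eq,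
    isBelowParent_nil.rootOccupied_iff_occupiedToDepth hinj hn', OccupiedToDepth]
  refine forall₂_congr fun i hi => ?_
  rw [not_and]
  refine imp_congr_right fun hlt => not_congr ?_
  have hd : ¬ HasDescent (childCount (subtree ω i)) (vertexLabel (subtree ω i)) n [] := by
    intro h
    exact hn' ⟨i, hi, hlt, (hasDescent_cons_iff _ _ n i []).2 h⟩
  have hinj' : Function.Injective (vertexLabel (subtree ω i)) := fun u v h => by
    simpa using hinj (a₁ := i :: u) (a₂ := i :: v) h
  rw [Set.mem_ofPred_eq, isBelowParent_nil.rootOccupied_iff_occupiedToDepth hinj' hd]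
  exact occupiedToDepth_cons_iff _ _ n i []

lemma probBelow_occupiedEvent (r : ℝ≥0) {t : ℝ} (ht0 : 0 ≤ t) (ht1 : t ≤ 1) :
    probBelow r occupiedEvent t =
      ∫ u in (0 : ℝ)..t, Real.exp (-r * probBelow r occupiedEvent u) := by
  rw [← probBelow_forall_not r measurableSet_occupiedEvent ht0 ht1]
  refine measureReal_congr ?_
  filter_upwards [occupiedEvent_ae_eq r] with ω hω
  exact propext (and_congr Iff.rfl hω)

/-- The solution of `f' = exp (-r f)`, `f 0 = 0`, at time `1`. -/
lemma eq_log_div_of_integral_eq {r : ℝ} (hr : 0 < r) {f : ℝ → ℝ}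
    (hexp : ∀ a b, IntervalIntegrable (fun u => Real.exp (-r * f u)) volume a b)
    (hf : ∀ t ∈ Set.Icc (0 : ℝ) 1, f t = ∫ u in (0 : ℝ)..t, Real.exp (-r * f u)) :
    f 1 = Real.log (1 + r) / r := by
  set F : ℝ → ℝ := fun t => ∫ u in (0 : ℝ)..t, Real.exp (-r * f u) with hF
  have hFc : Continuous F := intervalIntegral.continuous_primitive hexp 0
  have hderiv : ∀ t ∈ Set.Ioo (0 : ℝ) 1, HasDerivAt F (Real.exp (-r * F t)) t := by
    intro t ht
    have hnhds : Set.Ioo (0 : ℝ) 1 ∈ 𝓝 t := isOpen_Ioo.mem_nhds ht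
    -- Near `t`, `f` agrees with its continuous primitive `F`, so the integrand is continuous there
    -- and the fundamental theorem of calculus applies.
    have heq : (fun u => Real.exp (-r * F u)) =ᶠ[𝓝 t] fun u => Real.exp (-r * f u) := by
      filter_upwards [hnhds] with u hu
      rw [hf u ⟨hu.1.le, hu.2.le⟩]
    have hcF : Continuous fun u => Real.exp (-r * F u) := by fun_prop
    have hcont : ContinuousAt (fun u => Real.exp (-r * f u)) t := hcF.continuousAt.congr heq
    rw [heq.eq_of_nhds]
    refine intervalIntegral.integral_hasDerivAt_right (hexp _ _) ?_ hcont
    exact ⟨Set.Ioo 0 1, hnhds, (hcF.aestronglyMeasurable.restrict).congr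
      ((ae_restrict_mem measurableSet_Ioo).mono fun u hu => by
        simp only
        rw [hf u ⟨hu.1.le, hu.2.le⟩])⟩
  -- `exp (r F t) - r t` has zero derivative, so the mean value theorem equates its values at `0`
  -- and `1`.
  obtain ⟨x, hx, hslope⟩ := exists_hasDerivAt_eq_slope (fun t => Real.exp (r * F t) - r * t)
    (fun t => Real.exp (r * F t) * (r * Real.exp (-r * F t)) - r) zero_lt_one
    (by fun_prop) fun t ht =>
      ((hderiv t ht).const_mul r).exp.sub (by simpa using (hasDerivAt_id t).const_mul r)
  have h0 : F 0 = 0 := by simp [hF]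
  have hz : Real.exp (r * F x) * (r * Real.exp (-r * F x)) - r = 0 := by
    rw [mul_left_comm, ← Real.exp_add]
    simp
  rw [hz, h0] at hslope
  have h1 : Real.exp (r * F 1) = 1 + r := by
    simp at hslope
    linarith
  rw [hf 1 (by simp), eq_div_iff hr.ne', ← h1, Real.log_exp, mul_comm]

theorem rootDensity_poissonGW {r : ℝ≥0} (hr : 0 < r) :
    rootDensity (poissonGW r) [] = Real.log (1 + (r : ℝ)) / (r : ℝ) := by
  rw [rootDensity, poissonGW_prod_labelLaw,
    map_measureReal_apply measurable_labelledTree (measurableSet_rootOccupied [])]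
  change (labelledTreeLaw r).real occupiedEvent = _
  rw [← probBelow_one]
  exact eq_log_div_of_integral_eq (NNReal.coe_pos.2 hr) (intervalIntegrable_exp_probBelow r _)
    fun t ht => probBelow_occupiedEvent r ht.1 ht.2

end GaltonWatson

end

theorem mainTheorem7 (r : ℝ≥0) (hr : 0 < r) :
    (NonexplosiveGrowth (poissonGW r) [] ∧
      rootDensity (poissonGW r) [] = Real.log (1 + (r : ℝ)) / (r : ℝ)) ∧
    AsympWHP (binomialGraphOrderLaw r) (fun _ p => greedyDensity p.1 p.2)
      (Real.log (1 + (r : ℝ)) / (r : ℝ)) :=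
  ⟨⟨nonexplosiveGrowth_poissonGW r, rootDensity_poissonGW hr⟩,
    asympWHP_greedyDensity_binomialRandom hr⟩
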